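/- Let $n\ge 1$. Let $\mathcal I_n(321)$ be the set of permutations $\pi$ of $\{1,\dots,n\}$ with $\pi=\pi^{-1}$ for which there are no $i<j<k$ with $\pi(i)>\pi(j)>\pi(k)$. Let $\operatorname{maj}(\pi)$ be the sum of all $i$ with $1\le i<n$ and $\pi(i)>\pi(i+1)$, and for $0\le j\le n$ let $$\binom{n}{j}_q=\frac{(1-q^n)(1-q^{n-1})\cdots(1-q^{n-j+1})}{(1-q^j)(1-q^{j-1})\cdots(1-q)}.$$ Then $$\sum_{\pi\in\mathcal I_n(321)} q^{\operatorname{maj}(\pi)}=\binom{n}{\lfloor n/2\rfloor}_q .$$ Moreover (equivalently), for every integer $m\ge 0$, the number of $\pi\in\mathcal I_n(321)$ with $\operatorname{maj}(\pi)=m$ equals the number of partitions of $m$ whose Young diagram fits inside the box $B_n$ with $\lfloor n/2\rfloor$ rows and $\lceil n/2\rceil$ columns. -/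

import Mathlib

/-- The permutation `π(1) … π(n)` has no `i < j < k` with `π(i) > π(j) > π(k)`. The set
`{1, …, n}` is represented by `Fin n`, so that the number `i` is the element of value `i - 1`. -/
def Avoids321 {n : ℕ} (π : Equiv.Perm (Fin n)) : Prop :=
  ∀ i j k : Fin n, i < j → j < k → ¬ (π i > π j ∧ π j > π k)

instance {n : ℕ} : DecidablePred (Avoids321 (n := n)) := fun π =>
  inferInstanceAs (Decidable (∀ i j k : Fin n, i < j → j < k → ¬ (π i > π j ∧ π j > π k)))

/-- The set of `321`-avoiding involutions; the identity counts as an involution. -/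
def involutions321 (n : ℕ) : Finset (Equiv.Perm (Fin n)) :=
  {π | π = π⁻¹ ∧ Avoids321 π}

/-- The set of descent positions, numbered from `1`: the `i` with `1 ≤ i < n` and
`π(i) > π(i+1)`. The `i`-th entry is the value of `π` at the element `i - 1` of `Fin n`. -/
def descentSet {n : ℕ} (π : Equiv.Perm (Fin n)) : Finset ℕ :=
  {i ∈ Finset.Ico 1 n | ∃ h : i < n, π ⟨i - 1, by omega⟩ > π ⟨i, h⟩}

/-- The major index: the sum of the descent positions. -/
def majorIndex {n : ℕ} (π : Equiv.Perm (Fin n)) : ℕ :=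
  ∑ i ∈ descentSet π, i

/-- The `q`-binomial coefficient
`((1 - q^n) (1 - q^(n-1)) ⋯ (1 - q^(n-j+1))) / ((1 - q^j) (1 - q^(j-1)) ⋯ (1 - q))`,
as an element of the field `ℚ(q)` (it is meant for `j ≤ n`). -/
noncomputable def qBinomial (n j : ℕ) : RatFunc ℚ :=
  (∏ i ∈ Finset.range j, (1 - RatFunc.X ^ (n - i))) /
    (∏ i ∈ Finset.range j, (1 - RatFunc.X ^ (j - i)))

/-- The Young diagram of a partition: its rows are the parts in weakly decreasing order. -/
def partitionDiagram {m : ℕ} (lam : Nat.Partition m) : YoungDiagram :=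
  YoungDiagram.ofRowLens (lam.parts.sort (· ≥ ·)) (lam.parts.pairwise_sort (· ≥ ·)).sortedGE

/-- The Young diagram of `lam` fits inside the box with `⌊n/2⌋` rows and `⌈n/2⌉` columns
(cells are pairs (row, column), both numbered from `0`). -/
def FitsInBox (n : ℕ) {m : ℕ} (lam : Nat.Partition m) : Prop :=
  (partitionDiagram lam).cells ⊆ Finset.range (n / 2) ×ˢ Finset.range ((n + 1) / 2)

instance (n m : ℕ) : DecidablePred (FitsInBox n (m := m)) := fun lam =>
  inferInstanceAs (Decidable ((partitionDiagram lam).cells ⊆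
    Finset.range (n / 2) ×ˢ Finset.range ((n + 1) / 2)))

/-! A `321`-avoiding involution is one without nested cycles (fixed points included), and it is
determined by the set `D` of positions with `π i < i`. The sets that occur are exactly the ballot
sets (`isBallot_belowSet`, `belowSet_injOn`, `exists_avoids321`), and a descent is a non-element of
`D` followed by an element (`majorIndex_eq`). Bounding `|D|` by `b` gives polynomials with the
recursion `ballotPoly_succ_succ`, which Gaussian binomials also satisfy (`gaussPoly_succ_succ`).
Partitions in a box satisfy the Pascal recursion, so the second claim follows by comparing
coefficients. -/

/-! ### Gaussian binomials -/

open Polynomial in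
/-- The Gaussian binomial coefficient `[a + b choose a]`, by its Pascal recursion. -/
noncomputable def gaussPoly : ℕ → ℕ → ℚ[X]
  | 0, _ => 1
  | _ + 1, 0 => 1
  | a + 1, b + 1 => gaussPoly (a + 1) b + X ^ (b + 1) * gaussPoly a (b + 1)

open Polynomial in
/-- The product `(1 - q) (1 - q²) ⋯ (1 - qⁿ)`. -/
noncomputable def qFactorialPoly (n : ℕ) : ℚ[X] := ∏ i ∈ Finset.range n, (1 - X ^ (i + 1))

open Polynomial in
theorem qFactorialPoly_succ (n : ℕ) :
    qFactorialPoly (n + 1) = qFactorialPoly n * (1 - X ^ (n + 1)) :=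
  Finset.prod_range_succ _ _

open Polynomial in
theorem one_sub_X_pow_ne_zero (n : ℕ) : (1 - X ^ (n + 1) : ℚ[X]) ≠ 0 := by
  intro h
  have := congrArg (Polynomial.eval 0) h
  simp at this

theorem qFactorialPoly_ne_zero (n : ℕ) : qFactorialPoly n ≠ 0 :=
  Finset.prod_ne_zero_iff.2 fun i _ => one_sub_X_pow_ne_zero i

theorem gaussPoly_zero_right (a : ℕ) : gaussPoly a 0 = 1 := by
  cases a <;> simp [gaussPoly]

theorem gaussPoly_mul (a b : ℕ) :
    gaussPoly a b * (qFactorialPoly a * qFactorialPoly b) = qFactorialPoly (a + b) := by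
  induction a generalizing b with
  | zero => simp [gaussPoly, qFactorialPoly]
  | succ a iha =>
    induction b with
    | zero => simp [gaussPoly, qFactorialPoly]
    | succ b ihb =>
      have h := iha (b + 1)
      rw [show a + (b + 1) = a + 1 + b by ring] at h
      rw [gaussPoly, show a + 1 + (b + 1) = (a + 1 + b) + 1 by ring, qFactorialPoly_succ (a + 1 + b)]
      rw [qFactorialPoly_succ b] at h ⊢
      rw [qFactorialPoly_succ a] at ihb ⊢
      linear_combination (1 - Polynomial.X ^ (b + 1)) * ihb +
        Polynomial.X ^ (b + 1) * (1 - Polynomial.X ^ (a + 1)) * h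

theorem gaussPoly_comm (a b : ℕ) : gaussPoly a b = gaussPoly b a := by
  apply mul_right_cancel₀ (mul_ne_zero (qFactorialPoly_ne_zero a) (qFactorialPoly_ne_zero b))
  rw [gaussPoly_mul, mul_comm (qFactorialPoly a), gaussPoly_mul, add_comm]

/-- The coefficient depends on `a + b` only, unlike in the Pascal recursion; this is what lets it
match a recursion on subsets of `{0, …, n - 1}`. -/
theorem gaussPoly_succ_succ (a b : ℕ) :
    gaussPoly (a + 1) (b + 1) = gaussPoly a (b + 1) + gaussPoly (a + 1) b
      - (1 - Polynomial.X ^ (a + b + 1)) * gaussPoly a b := by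
  have h1 := gaussPoly_mul a (b + 1)
  have h2 := gaussPoly_mul a b
  have key : (1 - Polynomial.X ^ (b + 1)) * gaussPoly a (b + 1)
      = (1 - Polynomial.X ^ (a + b + 1)) * gaussPoly a b := by
    apply mul_right_cancel₀ (mul_ne_zero (qFactorialPoly_ne_zero a) (qFactorialPoly_ne_zero b))
    rw [← add_assoc, qFactorialPoly_succ, qFactorialPoly_succ] at h1
    linear_combination h1 - (1 - Polynomial.X ^ (a + b + 1)) * h2
  rw [gaussPoly]
  linear_combination -key

theorem algebraMap_gaussPoly (a b : ℕ) :
    algebraMap (Polynomial ℚ) (RatFunc ℚ) (gaussPoly a b) = qBinomial (a + b) b := by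
  have hF (m : ℕ) : algebraMap (Polynomial ℚ) (RatFunc ℚ) (qFactorialPoly m) ≠ 0 := by
    simpa using qFactorialPoly_ne_zero m
  have hden (m : ℕ) : ∏ i ∈ Finset.range m, (1 - (RatFunc.X : RatFunc ℚ) ^ (m - i))
      = algebraMap (Polynomial ℚ) (RatFunc ℚ) (qFactorialPoly m) := by
    rw [qFactorialPoly, ← Finset.prod_range_reflect, map_prod]
    refine Finset.prod_congr rfl fun i hi => ?_
    rw [Finset.mem_range] at hi
    rw [show m - (m - 1 - i) = i + 1 by omega]
    simp
  have hnum : (∏ i ∈ Finset.range b, (1 - (RatFunc.X : RatFunc ℚ) ^ (a + b - i)))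
      * algebraMap (Polynomial ℚ) (RatFunc ℚ) (qFactorialPoly a)
      = algebraMap (Polynomial ℚ) (RatFunc ℚ) (qFactorialPoly (a + b)) := by
    rw [← hden, ← hden, add_comm a b, Finset.prod_range_add]
    congr 1
    refine Finset.prod_congr rfl fun i _ => ?_
    rw [Nat.add_sub_add_left]
  rw [qBinomial, hden, eq_div_iff (hF b)]
  apply mul_right_cancel₀ (hF a)
  rw [hnum, ← gaussPoly_mul, map_mul, map_mul]
  ring

/-! ### Partitions in a box -/

/-- The multisets of at most `a` positive integers, all of them at most `b`. -/
def boxMultisets : ℕ → ℕ → Finset (Multiset ℕ)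
  | 0, _ => {0}
  | _ + 1, 0 => {0}
  | a + 1, b + 1 => boxMultisets (a + 1) b ∪ (boxMultisets a (b + 1)).image ((b + 1) ::ₘ ·)

theorem mem_boxMultisets {a b : ℕ} {s : Multiset ℕ} :
    s ∈ boxMultisets a b ↔ s.card ≤ a ∧ ∀ x ∈ s, 0 < x ∧ x ≤ b := by
  induction a generalizing b s with
  | zero =>
    simp only [boxMultisets, Finset.mem_singleton, nonpos_iff_eq_zero, Multiset.card_eq_zero]
    constructor
    · rintro rfl; simp
    · exact fun h => h.1
  | succ a iha =>
    induction b generalizing s with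
    | zero =>
      simp only [boxMultisets, Finset.mem_singleton]
      constructor
      · rintro rfl; simp
      · rintro ⟨-, h⟩
        exact Multiset.eq_zero_of_forall_notMem fun x hx => by have := h x hx; omega
    | succ b ihb =>
      simp only [boxMultisets, Finset.mem_union, Finset.mem_image, ihb, iha]
      constructor
      · rintro (⟨h1, h2⟩ | ⟨t, ⟨h1, h2⟩, rfl⟩)
        · exact ⟨h1, fun x hx => ⟨(h2 x hx).1, (h2 x hx).2.trans (Nat.le_succ b)⟩⟩
        · refine ⟨by simpa using h1, fun x hx => ?_⟩
          rcases Multiset.mem_cons.1 hx with rfl | hx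
          · exact ⟨Nat.succ_pos b, le_rfl⟩
          · exact h2 x hx
      · rintro ⟨h1, h2⟩
        by_cases hb : b + 1 ∈ s
        · right
          obtain ⟨t, rfl⟩ := Multiset.exists_cons_of_mem hb
          exact ⟨t, ⟨by simpa using h1, fun x hx => h2 x (Multiset.mem_cons_of_mem hx)⟩, rfl⟩
        · left
          refine ⟨h1, fun x hx => ⟨(h2 x hx).1, ?_⟩⟩
          have hne : x ≠ b + 1 := fun h => hb (h ▸ hx)
          have := (h2 x hx).2
          omega

theorem sum_boxMultisets (a b : ℕ) :
    ∑ s ∈ boxMultisets a b, (Polynomial.X : Polynomial ℚ) ^ s.sum = gaussPoly a b := by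
  induction a generalizing b with
  | zero => simp [boxMultisets, gaussPoly]
  | succ a iha =>
    induction b with
    | zero => simp [boxMultisets, gaussPoly]
    | succ b ihb =>
      rw [boxMultisets, Finset.sum_union, ihb, Finset.sum_image, gaussPoly, ← iha, Finset.mul_sum]
      · simp [pow_add]
      · intro s _ t _ h
        simpa using h
      · rw [Finset.disjoint_left]
        intro s hs hs'
        obtain ⟨t, -, rfl⟩ := Finset.mem_image.1 hs'
        have := ((mem_boxMultisets.1 hs).2 (b + 1) (Multiset.mem_cons_self _ _)).2
        omega

theorem fitsInBox_iff (n : ℕ) {m : ℕ} (lam : Nat.Partition m) :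
    FitsInBox n lam ↔ lam.parts ∈ boxMultisets (n / 2) ((n + 1) / 2) := by
  rw [mem_boxMultisets, FitsInBox]
  have hmem (c : ℕ × ℕ) : c ∈ (partitionDiagram lam).cells ↔
      ∃ h : c.1 < (lam.parts.sort (· ≥ ·)).length, c.2 < (lam.parts.sort (· ≥ ·))[c.1] := by
    rw [YoungDiagram.mem_cells, partitionDiagram, YoungDiagram.mem_ofRowLens]
  constructor
  · intro h
    have hpos (i : ℕ) (hi : i < (lam.parts.sort (· ≥ ·)).length) :
        0 < (lam.parts.sort (· ≥ ·))[i] :=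
      lam.parts_pos ((Multiset.mem_sort _).1 (List.getElem_mem hi))
    constructor
    -- With too many parts, the cell `(n / 2, 0)` would lie in the diagram.
    · by_contra! hc
      have := h ((hmem (n / 2, 0)).2 ⟨by simpa using hc, hpos _ _⟩)
      simp at this
    · intro x hx
      refine ⟨lam.parts_pos hx, ?_⟩
      obtain ⟨i, hi, rfl⟩ := List.getElem_of_mem ((Multiset.mem_sort (· ≥ ·)).2 hx)
      have := hpos i hi
      have h2 := h ((hmem (i, (lam.parts.sort (· ≥ ·))[i] - 1)).2 ⟨hi, by simp only; omega⟩)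
      simp only [Finset.mem_product, Finset.mem_range] at h2
      omega
  · rintro ⟨h1, h2⟩ c hc
    obtain ⟨h, h'⟩ := (hmem c).1 hc
    have h3 := (h2 _ ((Multiset.mem_sort _).1 (List.getElem_mem h))).2
    rw [Multiset.length_sort] at h
    rw [Finset.mem_product, Finset.mem_range, Finset.mem_range]
    omega

theorem coeff_sum_X_pow {ι : Type*} (s : Finset ι) (f : ι → ℕ) (m : ℕ) :
    (∑ i ∈ s, (Polynomial.X : Polynomial ℚ) ^ f i).coeff m = (s.filter (f · = m)).card := by
  simp [Polynomial.coeff_X_pow, eq_comm]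

theorem card_fitsInBox (n m : ℕ) :
    Finset.card {lam : Nat.Partition m | FitsInBox n lam} =
      ((boxMultisets (n / 2) ((n + 1) / 2)).filter (·.sum = m)).card := by
  refine Finset.card_bij (fun lam _ => lam.parts) ?_ ?_ ?_
  · intro lam h
    rw [Finset.mem_filter_univ, fitsInBox_iff] at h
    exact Finset.mem_filter.2 ⟨h, lam.parts_sum⟩
  · exact fun _ _ _ _ h => Nat.Partition.ext h
  · intro s hs
    obtain ⟨h1, h2⟩ := Finset.mem_filter.1 hs
    refine ⟨⟨s, fun hi => ((mem_boxMultisets.1 h1).2 _ hi).1, h2⟩, ?_, rfl⟩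
    rw [Finset.mem_filter_univ, fitsInBox_iff]
    exact h1
-- Involutions and ballot sets
/-- Every initial segment `{0, …, i - 1}` has at least as many elements outside `D` as in `D`. -/
def IsBallot (D : Finset ℕ) : Prop := ∀ i, 2 * (D.filter (· < i)).card ≤ i

/-- The set of elements below their position. -/
def belowSet {n : ℕ} (π : Equiv.Perm (Fin n)) : Finset ℕ :=
  (Finset.univ.filter fun i => π i < i).map Fin.valEmbedding

theorem val_mem_belowSet {n : ℕ} {π : Equiv.Perm (Fin n)} {i : Fin n} :
    (i : ℕ) ∈ belowSet π ↔ π i < i := by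
  simp [belowSet, Fin.val_inj]

theorem lt_of_mem_belowSet {n : ℕ} {π : Equiv.Perm (Fin n)} {i : ℕ} (h : i ∈ belowSet π) :
    i < n := by
  obtain ⟨j, -, rfl⟩ := Finset.mem_map.1 h
  exact j.2

theorem belowSet_eq_iff {n : ℕ} {π : Equiv.Perm (Fin n)} {D : Finset ℕ}
    (hD : D ⊆ Finset.range n) : belowSet π = D ↔ ∀ i : Fin n, (i : ℕ) ∈ D ↔ π i < i := by
  constructor
  · rintro rfl i
    exact val_mem_belowSet
  · intro h
    ext i
    constructor
    · intro hi
      lift i to Fin n using lt_of_mem_belowSet hi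
      exact (h i).2 (val_mem_belowSet.1 hi)
    · intro hi
      lift i to Fin n using Finset.mem_range.1 (hD hi)
      exact val_mem_belowSet.2 ((h i).1 hi)

theorem eq_inv_iff_involutive {α : Type*} {π : Equiv.Perm α} :
    π = π⁻¹ ↔ Function.Involutive π := by
  constructor
  · intro h x
    conv_lhs => enter [1]; rw [h]
    simp
  · intro h
    ext x
    rw [Equiv.Perm.eq_inv_iff_eq, h x]

/-- An involution avoids `321` if and only if it has no two nested cycles. -/
theorem avoids321_iff {n : ℕ} {π : Equiv.Perm (Fin n)} (hπ : Function.Involutive π) :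
    Avoids321 π ↔ ∀ i j, i < j → j ≤ π j → ¬ π j < π i := by
  constructor
  · intro h i j hij hj hji
    rcases hj.eq_or_lt with hj | hj
    · exact h i j (π i) hij (hj.trans_lt hji) ⟨hji, by rw [hπ, ← hj]; exact hij⟩
    · exact h i j (π j) hij hj ⟨hji, by rw [hπ]; exact hj⟩
  · rintro h i j k hij hjk ⟨h1, h2⟩
    -- The cycle of `j` is nested inside that of `i` if `j ≤ π j`, and inside that of `k` otherwise.
    rcases le_or_gt j (π j) with hj | hj
    · exact h i j hij hj h1
    · exact h (π k) (π j) h2 (by rw [hπ]; exact hj.le) (by rw [hπ, hπ]; exact hjk)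

/-- `π` injects the elements of `D` below `i` into the non-elements below `i`. -/
theorem isBallot_belowSet {n : ℕ} {π : Equiv.Perm (Fin n)} (hπ : Function.Involutive π) :
    IsBallot (belowSet π) := by
  intro i
  have h1 : ((belowSet π).filter (· < i)).card =
      (Finset.univ.filter fun x : Fin n => (x : ℕ) < i ∧ π x < x).card := by
    rw [belowSet, Finset.filter_map, Finset.card_map, Finset.filter_filter]
    simp [and_comm]
  have h2 : (Finset.univ.filter fun x : Fin n => (x : ℕ) < i ∧ π x < x).card ≤
      (Finset.univ.filter fun x : Fin n => (x : ℕ) < i ∧ ¬ π x < x).card := by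
    refine Finset.card_le_card_of_injOn π ?_ π.injective.injOn
    intro x hx
    simp only [Finset.coe_filter, Finset.mem_univ, true_and, Set.mem_ofPred_eq, hπ x] at hx ⊢
    exact ⟨lt_trans hx.2 hx.1, hx.2.not_gt⟩
  have h3 : (Finset.univ.filter fun x : Fin n => (x : ℕ) < i).card ≤ i := by
    rw [← Finset.card_map Fin.valEmbedding]
    refine (Finset.card_le_card (t := Finset.range i) fun x hx => ?_).trans (by simp)
    simp only [Finset.mem_map, Finset.mem_filter_univ] at hx
    obtain ⟨y, hy, rfl⟩ := hx
    simpa using hy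
  rw [← Finset.card_filter_add_card_filter_not (fun x => π x < x), Finset.filter_filter,
    Finset.filter_filter] at h3
  omega

/-- At the largest disagreement `i`, say `π i < σ i`, both values are below `i`. Non-nesting in `π`
forces `i ≤ π (σ i)`: equality is absurd, and beyond `i` the two agree. -/
theorem belowSet_injOn {n : ℕ} {π σ : Equiv.Perm (Fin n)} (hπ : Function.Involutive π)
    (hσ : Function.Involutive σ) (hπ' : Avoids321 π) (hσ' : Avoids321 σ)
    (h : belowSet π = belowSet σ) : π = σ := by
  have hb (i : Fin n) : π i < i ↔ σ i < i := by
    rw [← val_mem_belowSet, ← val_mem_belowSet, h]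
  rw [avoids321_iff hπ] at hπ'
  rw [avoids321_iff hσ] at hσ'
  by_contra hne
  obtain ⟨i, hi, hmax⟩ := Finset.exists_max_image (Finset.univ.filter fun i => π i ≠ σ i) id <| by
    by_contra hem
    apply hne
    ext i
    rw [Finset.not_nonempty_iff_eq_empty, Finset.filter_eq_empty_iff] at hem
    rw [not_not.1 (hem (Finset.mem_univ i))]
  rw [Finset.mem_filter_univ] at hi
  have hagree (j : Fin n) (hj : i < j) : π j = σ j := by
    by_contra hc
    exact hj.not_ge (hmax j (by simpa using hc))
  have key (π σ : Equiv.Perm (Fin n)) (hπ : Function.Involutive π)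
      (hσ : Function.Involutive σ) (hπ' : ∀ i j, i < j → j ≤ π j → ¬ π j < π i)
      (hb : ∀ i, π i < i ↔ σ i < i) (hagree : ∀ j, i < j → π j = σ j) : ¬ π i < σ i := by
    intro hlt
    have h1 : ¬ i < σ i := by
      intro h
      have := hagree _ h
      rw [hσ] at this
      have h2 := hπ (σ i)
      rw [this] at h2
      exact hlt.ne h2
    have h2 : σ i < i := (hb i).1 (hlt.trans_le (not_lt.1 h1))
    have h3 : σ i ≤ π (σ i) := by
      rw [← not_lt, hb, hσ]
      exact h2.not_gt
    have h4 : i ≤ π (σ i) := by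
      have := hπ' _ _ hlt h3
      rw [hπ] at this
      exact not_lt.1 this
    rcases h4.eq_or_lt with h4 | h4
    · have := congrArg π h4
      rw [hπ] at this
      exact hlt.ne this
    · have h5 := hagree _ h4
      rw [hπ] at h5
      have h6 := congrArg σ h5
      rw [hσ, hσ] at h6
      exact h4.ne h6
  rcases lt_or_gt_of_ne hi with h | h
  · exact key π σ hπ hσ hπ' hb hagree h
  · exact key σ π hσ hπ hσ' (fun i => (hb i).symm) (fun j hj => (hagree j hj).symm) h

theorem IsBallot.mono {D E : Finset ℕ} (h : IsBallot D) (hE : E ⊆ D) : IsBallot E := fun i =>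
  (Nat.mul_le_mul_left 2 (Finset.card_le_card (Finset.filter_subset_filter _ hE))).trans (h i)

theorem exists_involutive_nat {n : ℕ} {D : Finset ℕ} (hD : D ⊆ Finset.range n)
    (hB : IsBallot D) : ∃ f : ℕ → ℕ, Function.Involutive f ∧ (∀ i, n ≤ i → f i = i) ∧
      ∀ i, i ∈ D ↔ f i < i := by
  induction n generalizing D with
  | zero =>
    refine ⟨id, fun _ => rfl, fun _ _ => rfl, fun i => ?_⟩
    simp [Finset.subset_empty.1 hD]
  | succ n ih =>
    have hD' : D.erase n ⊆ Finset.range n := by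
      rw [Finset.range_add_one] at hD
      exact Finset.subset_insert_iff.1 hD
    obtain ⟨f, hf, hfix, hf'⟩ := ih hD' (hB.mono (Finset.erase_subset _ _))
    by_cases hn : n ∈ D
    · have hcard : 2 * ((D.erase n).card + 1) ≤ n + 1 := by
        have := hB (n + 1)
        rwa [Finset.filter_true_of_mem fun x hx => Finset.mem_range.1 (hD hx),
          ← Finset.card_erase_add_one hn] at this
      obtain ⟨j, hj, hfj⟩ : ∃ j < n, f j = j := by
        -- Without a fixed point below `n`, the set `D.erase n` and its image cover `range n`,
        -- against the ballot bound.
        by_contra! hc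
        have hsub : Finset.range n ⊆ D.erase n ∪ (D.erase n).image f := by
          intro x hx
          rw [Finset.mem_range] at hx
          rw [Finset.mem_union, Finset.mem_image]
          rcases lt_or_gt_of_ne (hc x hx) with h | h
          · exact Or.inl ((hf' x).2 h)
          · exact Or.inr ⟨f x, (hf' _).2 (by rwa [hf]), hf x⟩
        have h1 := Finset.card_le_card hsub
        have h2 := Finset.card_union_le (D.erase n) ((D.erase n).image f)
        have h3 := Finset.card_image_le (s := D.erase n) (f := f)
        rw [Finset.card_range] at h1
        omega
      have hfn : f n = n := hfix n le_rfl
      have hne (x : ℕ) (h1 : x ≠ n) (h2 : x ≠ j) : f x ≠ n ∧ f x ≠ j := by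
        constructor
        · intro h; apply h1; rw [← hf x, h, hfn]
        · intro h; apply h2; rw [← hf x, h, hfj]
      -- Still an involution, since `f` fixes both `j` and `n`.
      refine ⟨fun x => Equiv.swap j n (f x), fun x => ?_, fun i hi => ?_, fun i => ?_⟩
      · by_cases h1 : x = n
        · subst h1; simp [hfn, hfj]
        by_cases h2 : x = j
        · subst h2; simp [hfn, hfj]
        have h3 := hne x h1 h2
        simp only [Equiv.swap_apply_of_ne_of_ne h3.2 h3.1, hf x,
          Equiv.swap_apply_of_ne_of_ne h2 h1]
      · simp only [hfix i (by omega)]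
        exact Equiv.swap_apply_of_ne_of_ne (by omega) (by omega)
      · by_cases h1 : i = n
        · subst h1; simp [hfn, hn, hj]
        by_cases h2 : i = j
        · subst h2
          have := hf' i
          simp only [Finset.mem_erase, hfj, lt_irrefl, iff_false, not_and] at this
          simp [hfj, this h1, hj.le]
        have h3 := hne i h1 h2
        simp only [Equiv.swap_apply_of_ne_of_ne h3.2 h3.1, ← hf', Finset.mem_erase]
        simp [h1]
    · rw [Finset.erase_eq_of_notMem hn] at hf'
      exact ⟨f, hf, fun i hi => hfix i (by omega), hf'⟩

theorem exists_involutive_perm {n : ℕ} {D : Finset ℕ} (hD : D ⊆ Finset.range n)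
    (hB : IsBallot D) : ∃ π : Equiv.Perm (Fin n), Function.Involutive π ∧ belowSet π = D := by
  obtain ⟨f, hf, hfix, hf'⟩ := exists_involutive_nat hD hB
  have hlt (i : Fin n) : f i < n := by
    by_contra! h
    have := hfix _ h
    rw [hf] at this
    omega
  have hinv : Function.Involutive fun i : Fin n => (⟨f i, hlt i⟩ : Fin n) :=
    fun i => Fin.ext (hf i)
  refine ⟨hinv.toPerm, hinv, (belowSet_eq_iff hD).2 fun i => hf' i⟩

/-- Replacing a nested pair of cycles by a non-nested one. -/
theorem exists_lex_lt {n : ℕ} {π : Equiv.Perm (Fin n)} (hπ : Function.Involutive π)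
    {i j : Fin n} (hij : i < j) (hj : j ≤ π j) (hji : π j < π i) :
    ∃ σ : Equiv.Perm (Fin n), Function.Involutive σ ∧ belowSet σ = belowSet π ∧
      toLex (σ : Fin n → Fin n) < toLex (π : Fin n → Fin n) := by
  set s := Equiv.swap i j with hs
  have hout (x : Fin n) (h1 : x ≠ i) (h2 : x ≠ j) : s x = x := Equiv.swap_apply_of_ne_of_ne h1 h2
  have hsi : s i = j := Equiv.swap_apply_left _ _
  have hsj : s j = i := Equiv.swap_apply_right _ _
  have hσi : s (π (s i)) < π i := by
    rw [hsi]
    rcases hj.eq_or_lt with h | h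
    · rw [← h, hsj]; omega
    · rw [hout _ (by omega) (by omega)]; exact hji
  have hσi' : i ≤ s (π (s i)) := by
    rw [hsi]
    rcases hj.eq_or_lt with h | h
    · rw [← h, hsj]
    · rw [hout _ (by omega) (by omega)]; omega
  -- Conjugation pairs `i` with `π j` and `j` with `π i`; if `j` was fixed, `i` becomes fixed
  -- instead.
  refine ⟨s * π * s, fun x => ?_, ?_, ?_⟩
  · simp [hs, hπ _]
  · rw [belowSet_eq_iff fun i hi => Finset.mem_range.2 (lt_of_mem_belowSet hi)]
    intro x
    rw [val_mem_belowSet]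
    simp only [Equiv.Perm.coe_mul, Function.comp_apply]
    by_cases hxi : x = i
    · subst hxi
      constructor <;> intro h <;> omega
    by_cases hxj : x = j
    · subst hxj
      rw [hsj, hout (π i) (by omega) (by omega)]
      constructor <;> intro h <;> omega
    rw [hout x hxi hxj]
    by_cases h1 : π x = i
    · have : x = π i := by rw [← h1, hπ]
      rw [h1, hsi]
      constructor <;> intro h <;> omega
    by_cases h2 : π x = j
    · have : x = π j := by rw [← h2, hπ]
      rw [h2, hsj]
      constructor <;> intro h <;> omega
    rw [hout _ h1 h2]
  · refine ⟨i, fun x hx => ?_, hσi⟩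
    change s (π (s x)) = π x
    rw [hout x (by omega) (by omega)]
    apply hout <;> intro h
    · have h' := hπ x
      rw [h] at h'
      omega
    · have h' := hπ x
      rw [h] at h'
      omega

/-- The lexicographically least involution with the given set has no nesting, by `exists_lex_lt`. -/
theorem exists_avoids321 {n : ℕ} {D : Finset ℕ} (hD : D ⊆ Finset.range n)
    (hB : IsBallot D) :
    ∃ π : Equiv.Perm (Fin n), (Function.Involutive π ∧ belowSet π = D) ∧ Avoids321 π := by
  classical
  obtain ⟨π₀, h₀⟩ := exists_involutive_perm hD hB
  obtain ⟨π, hπ, hmin⟩ := Finset.exists_min_image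
    (Finset.univ.filter fun π : Equiv.Perm (Fin n) => Function.Involutive π ∧ belowSet π = D)
    (fun π => toLex (π : Fin n → Fin n)) ⟨π₀, by simpa using h₀⟩
  rw [Finset.mem_filter_univ] at hπ
  refine ⟨π, hπ, (avoids321_iff hπ.1).2 fun i j hij hj hji => ?_⟩
  obtain ⟨σ, h1, h2, h3⟩ := exists_lex_lt hπ.1 hij hj hji
  exact (hmin σ (by simpa [h1, h2] using hπ.2)).not_gt h3

/-- The sum of the elements of `D` whose predecessor is not in `D`. -/
def majSet (D : Finset ℕ) : ℕ := ∑ i ∈ D with i - 1 ∉ D, i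

/-- Descent position `i`, numbered from `1`, compares the elements `i - 1` and `i` of `Fin n`, so no
shift arises. -/
theorem majorIndex_eq {n : ℕ} {π : Equiv.Perm (Fin n)} (hπ : Function.Involutive π)
    (hπ' : Avoids321 π) : majorIndex π = majSet (belowSet π) := by
  rw [avoids321_iff hπ] at hπ'
  rw [majorIndex, majSet]
  congr 1
  ext i
  simp only [descentSet, Finset.mem_filter, Finset.mem_Ico]
  have key (a b : Fin n) (hab : (a : ℕ) + 1 = b) : π b < π a ↔ π b < b ∧ ¬ π a < a := by
    have hab' : a < b := by rw [Fin.lt_def]; omega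
    constructor
    · refine fun h => ⟨?_, fun ha => ?_⟩
      · by_contra! hb
        exact hπ' a b hab' hb h
      · exact hπ' (π b) (π a) h (by rw [hπ]; exact ha.le) (by rw [hπ, hπ]; exact hab')
    · rintro ⟨h1, h2⟩
      have hne : π b ≠ π a := fun h => hab'.ne' (π.injective h)
      omega
  constructor
  · rintro ⟨⟨h1, -⟩, h2, h3⟩
    have := (key ⟨i - 1, by omega⟩ ⟨i, h2⟩ (by simp only; omega)).1 h3
    rw [← val_mem_belowSet, ← val_mem_belowSet] at this
    exact this
  · rintro ⟨h1, h2⟩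
    have hi := lt_of_mem_belowSet h1
    -- Truncated subtraction gives `0 - 1 = 0`, so `0 ∈ D` is never counted.
    have hi0 : i ≠ 0 := by
      rintro rfl
      exact h2 h1
    refine ⟨⟨by omega, hi⟩, hi, (key ⟨i - 1, by omega⟩ ⟨i, hi⟩ (by simp only; omega)).2 ?_⟩
    rw [← val_mem_belowSet, ← val_mem_belowSet]
    exact ⟨h1, h2⟩
-- Generating function of ballot sets
open Classical in
/-- The ballot subsets of `{0, …, n - 1}` with at most `b` elements. -/
noncomputable def ballotSets (n b : ℕ) : Finset (Finset ℕ) :=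
  (Finset.range n).powerset.filter fun D => IsBallot D ∧ D.card ≤ b

theorem mem_ballotSets {n b : ℕ} {D : Finset ℕ} :
    D ∈ ballotSets n b ↔ D ⊆ Finset.range n ∧ IsBallot D ∧ D.card ≤ b := by
  simp [ballotSets]

theorem IsBallot.two_mul_card_le {n : ℕ} {D : Finset ℕ} (h : IsBallot D)
    (hD : D ⊆ Finset.range n) : 2 * D.card ≤ n := by
  have := h n
  rwa [Finset.filter_true_of_mem fun x hx => Finset.mem_range.1 (hD hx)] at this

theorem IsBallot.insert {n : ℕ} {D : Finset ℕ} (h : IsBallot D)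
    (hc : 2 * (D.card + 1) ≤ n + 1) : IsBallot (insert n D) := by
  intro i
  rw [Finset.filter_insert]
  split_ifs with hi
  · have h1 := Finset.card_insert_le n (D.filter (· < i))
    have h2 := Finset.card_filter_le D (· < i)
    omega
  · exact h i

theorem ballotSets_zero (n : ℕ) : ballotSets n 0 = {∅} := by
  ext D
  rw [mem_ballotSets, Finset.mem_singleton, Nat.le_zero, Finset.card_eq_zero]
  constructor
  · exact fun h => h.2.2
  · rintro rfl
    exact ⟨Finset.empty_subset _, fun i => by simp, rfl⟩

theorem sum_ballotSets_succ {n b : ℕ} (h : 2 * (b + 1) ≤ n + 1)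
    (f : Finset ℕ → Polynomial ℚ) :
    ∑ D ∈ ballotSets (n + 1) (b + 1), f D =
      ∑ D ∈ ballotSets n (b + 1), f D + ∑ D ∈ ballotSets n b, f (insert n D) := by
  have hn {c : ℕ} {D : Finset ℕ} (hD : D ∈ ballotSets n c) : n ∉ D := fun hc => by
    simpa using (mem_ballotSets.1 hD).1 hc
  have hun : ballotSets (n + 1) (b + 1) =
      ballotSets n (b + 1) ∪ (ballotSets n b).image (insert n) := by
    ext D
    rw [Finset.mem_union, Finset.mem_image]
    constructor
    · intro hD
      obtain ⟨h1, h2, h3⟩ := mem_ballotSets.1 hD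
      rw [Finset.range_add_one] at h1
      by_cases hnD : n ∈ D
      · refine Or.inr ⟨D.erase n, mem_ballotSets.2 ⟨Finset.subset_insert_iff.1 h1,
          h2.mono (Finset.erase_subset _ _), ?_⟩, Finset.insert_erase hnD⟩
        rw [Finset.card_erase_of_mem hnD]
        omega
      · exact Or.inl (mem_ballotSets.2
          ⟨(Finset.subset_insert_iff_of_notMem hnD).1 h1, h2, h3⟩)
    · rintro (hD | ⟨E, hE, rfl⟩)
      · obtain ⟨h1, h2, h3⟩ := mem_ballotSets.1 hD
        exact mem_ballotSets.2
          ⟨h1.trans (Finset.range_subset_range.2 (Nat.le_succ n)), h2, h3⟩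
      · obtain ⟨h1, h2, h3⟩ := mem_ballotSets.1 hE
        refine mem_ballotSets.2 ⟨?_, h2.insert (by omega), ?_⟩
        · rw [Finset.range_add_one]
          exact Finset.insert_subset_insert n h1
        · exact (Finset.card_insert_le n E).trans (by omega)
  rw [hun, Finset.sum_union, Finset.sum_image]
  · intro D hD E hE hDE
    rw [← Finset.erase_insert (hn hD), ← Finset.erase_insert (hn hE)]
    exact congrArg (Finset.erase · n) hDE
  · rw [Finset.disjoint_left]
    intro D hD hD'
    obtain ⟨E, -, rfl⟩ := Finset.mem_image.1 hD'
    exact hn hD (Finset.mem_insert_self _ _)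

theorem majSet_insert_succ {n : ℕ} {D : Finset ℕ} (hD : D ⊆ Finset.range n) :
    majSet (insert (n + 1) D) = majSet D + (n + 1) := by
  have hlt (x : ℕ) (hx : x ∈ D) : x < n := Finset.mem_range.1 (hD hx)
  have hn : n + 1 ∉ D := fun h => by have := hlt _ h; omega
  have hn' : n ∉ D := fun h => by have := hlt _ h; omega
  rw [majSet, majSet, Finset.filter_insert, if_pos (by simpa using hn'),
    Finset.sum_insert (by simp [hn]), add_comm]
  congr 2
  refine Finset.filter_congr fun x hx => ?_
  have := hlt x hx
  rw [Finset.mem_insert, or_iff_right (by omega)]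

theorem majSet_insert_succ_insert {n : ℕ} {D : Finset ℕ} (hD : D ⊆ Finset.range n) :
    majSet (insert (n + 1) (insert n D)) = majSet (insert n D) := by
  have hlt (x : ℕ) (hx : x ∈ insert n D) : x ≤ n := by
    rcases Finset.mem_insert.1 hx with rfl | hx
    · rfl
    · exact (Finset.mem_range.1 (hD hx)).le
  rw [majSet, majSet, Finset.filter_insert, if_neg (by simp)]
  congr 1
  refine Finset.filter_congr fun x hx => ?_
  have := hlt x hx
  rw [Finset.mem_insert, or_iff_right (by omega)]

/-- The generating function of the ballot subsets of `{0, …, n - 1}` with at most `b` elements. -/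
noncomputable def ballotPoly (n b : ℕ) : Polynomial ℚ :=
  ∑ D ∈ ballotSets n b, Polynomial.X ^ majSet D

theorem ballotPoly_zero (n : ℕ) : ballotPoly n 0 = 1 := by
  simp [ballotPoly, ballotSets_zero, majSet]

/-- Adding `n + 1` leaves the weight of sets containing `n` unchanged and multiplies that of the
others by `X ^ (n + 1)`. -/
theorem sum_ballotSets_insert {n b : ℕ} (h : 2 * b ≤ n + 1) :
    ∑ D ∈ ballotSets (n + 1) b, (Polynomial.X : Polynomial ℚ) ^ majSet (insert (n + 1) D) =
      ballotPoly (n + 1) b - (1 - Polynomial.X ^ (n + 1)) * ballotPoly n b := by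
  have hmul (c : ℕ) :
      ∑ D ∈ ballotSets n c, (Polynomial.X : Polynomial ℚ) ^ majSet (insert (n + 1) D) =
        Polynomial.X ^ (n + 1) * ballotPoly n c := by
    rw [ballotPoly, Finset.mul_sum]
    refine Finset.sum_congr rfl fun D hD => ?_
    rw [majSet_insert_succ (mem_ballotSets.1 hD).1, pow_add, mul_comm]
  cases b with
  | zero =>
    have := hmul 0
    rw [ballotSets_zero] at this ⊢
    rw [this, ballotPoly_zero, ballotPoly_zero]
    ring
  | succ b =>
    have h1 := sum_ballotSets_succ h fun D => (Polynomial.X : Polynomial ℚ) ^ majSet D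
    rw [sum_ballotSets_succ h, hmul, show ballotPoly (n + 1) (b + 1) = _ from h1, ← ballotPoly]
    rw [Finset.sum_congr rfl fun D hD => by
      rw [majSet_insert_succ_insert (mem_ballotSets.1 hD).1]]
    ring

theorem ballotPoly_succ_succ {n b : ℕ} (h : 2 * b ≤ n) :
    ballotPoly (n + 2) (b + 1) = ballotPoly (n + 1) (b + 1) + ballotPoly (n + 1) b
      - (1 - Polynomial.X ^ (n + 1)) * ballotPoly n b := by
  rw [ballotPoly, sum_ballotSets_succ (by omega), sum_ballotSets_insert (by omega), ← ballotPoly]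
  ring

theorem ballotPoly_eq_of_le {n b c : ℕ} (hb : n ≤ 2 * b + 1) (hc : b ≤ c) :
    ballotPoly n c = ballotPoly n b := by
  rw [ballotPoly, ballotPoly]
  congr 1
  ext D
  rw [mem_ballotSets, mem_ballotSets]
  refine and_congr_right fun h1 => and_congr_right fun h2 => ?_
  have := h2.two_mul_card_le h1
  omega

/-- The boundary case `b = a + 1` is needed by the recursion at `b = a`. There no ballot set reaches
the size bound, so `b` may drop to `a`, and symmetry of Gaussian binomials concludes. -/
theorem ballotPoly_eq_gaussPoly (n a b : ℕ) (hn : a + b = n) (hab : b ≤ a + 1) :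
    ballotPoly n b = gaussPoly a b := by
  induction n using Nat.strong_induction_on generalizing a b with
  | _ n ih =>
  have main (a b : ℕ) (hn : a + b = n) (hab : b ≤ a) : ballotPoly n b = gaussPoly a b := by
    rcases b with _ | b
    · rw [ballotPoly_zero, gaussPoly_zero_right]
    obtain ⟨a, rfl⟩ : ∃ a', a = a' + 1 := ⟨a - 1, by omega⟩
    obtain rfl : n = a + b + 2 := by omega
    rw [ballotPoly_succ_succ (by omega), gaussPoly_succ_succ,
      ih (a + b + 1) (by omega) a (b + 1) (by omega) (by omega),
      ih (a + b + 1) (by omega) (a + 1) b (by omega) (by omega),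
      ih (a + b) (by omega) a b rfl (by omega)]
  rcases hab.lt_or_eq with h | rfl
  · exact main a b hn (by omega)
  · rw [ballotPoly_eq_of_le (b := a) (by omega) (by omega), main (a + 1) a (by omega) (by omega),
      gaussPoly_comm]

/-! ### Conclusion -/

theorem sum_involutions321 (n : ℕ) :
    ∑ π ∈ involutions321 n, (Polynomial.X : Polynomial ℚ) ^ majorIndex π =
      gaussPoly ((n + 1) / 2) (n / 2) := by
  have hmem (π : Equiv.Perm (Fin n)) :
      π ∈ involutions321 n ↔ Function.Involutive π ∧ Avoids321 π := by
    rw [involutions321, Finset.mem_filter_univ, eq_inv_iff_involutive]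
  rw [← ballotPoly_eq_gaussPoly n _ _ (by omega) (by omega), ballotPoly]
  refine Finset.sum_bij (fun π _ => belowSet π) ?_ ?_ ?_ ?_
  · intro π hπ
    have hB := isBallot_belowSet ((hmem π).1 hπ).1
    have hsub : belowSet π ⊆ Finset.range n := fun i hi =>
      Finset.mem_range.2 (lt_of_mem_belowSet hi)
    have := hB.two_mul_card_le hsub
    exact mem_ballotSets.2 ⟨hsub, hB, by omega⟩
  · intro π hπ σ hσ h
    rw [hmem] at hπ hσ
    exact belowSet_injOn hπ.1 hσ.1 hπ.2 hσ.2 h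
  · intro D hD
    obtain ⟨h1, h2, -⟩ := mem_ballotSets.1 hD
    obtain ⟨π, ⟨h3, h4⟩, h5⟩ := exists_avoids321 h1 h2
    exact ⟨π, (hmem π).2 ⟨h3, h5⟩, h4⟩
  · intro π hπ
    rw [hmem] at hπ
    rw [majorIndex_eq hπ.1 hπ.2]

theorem mainTheorem2 (n : ℕ) (hn : 1 ≤ n) :
    (∑ π ∈ involutions321 n, (RatFunc.X : RatFunc ℚ) ^ majorIndex π = qBinomial n (n / 2)) ∧
    (∀ m : ℕ,
      (Finset.card {π ∈ involutions321 n | majorIndex π = m}) =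
        Finset.card {lam : Nat.Partition m | FitsInBox n lam}) := by
  constructor
  · have h := congrArg (algebraMap (Polynomial ℚ) (RatFunc ℚ)) (sum_involutions321 n)
    rw [algebraMap_gaussPoly, show (n + 1) / 2 + n / 2 = n by omega] at h
    simpa using h
  · intro m
    have h := congrArg (Polynomial.coeff · m) (sum_involutions321 n)
    simp only [gaussPoly_comm _ (n / 2), ← sum_boxMultisets, coeff_sum_X_pow] at h
    rw [card_fitsInBox]
    exact_mod_cast h
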